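/- A finite set $s\subseteq\mathbb{N}$ is \emph{exactly $\omega$-large} if it is nonempty and $|s| = 1+\min s$; for $X\subseteq\mathbb{N}$, let $[X]^{!\omega}$ denote the family of all exactly $\omega$-large subsets of $X$. A coloring $f:[\mathbb{N}]^{!\omega}\to\mathbb{N}$ is \emph{computable} if $f(s)$ can be computed from the increasing sequence of the elements of $s$. A set $H\subseteq\mathbb{N}$ is \emph{$f$-free} if $f(s)\notin H\setminus s$ for every $s\in[H]^{!\omega}$. Let $X'$ be the Turing jump of $X$, let $\emptyset^{(0)}=\emptyset$ and $\emptyset^{(n+1)}=(\emptyset^{(n)})'$, and let $\emptyset^{(\omega)}=\bigoplus_{n}\emptyset^{(n)}=\{\langle n,x\rangle : x\in\emptyset^{(n)}\}$. There exists a computable coloring $f:[\mathbb{N}]^{!\omega}\to\mathbb{N}$ such that every infinite $f$-free set $H\subseteq\mathbb{N}$ computes $\emptyset^{(\omega)}$, that is, $\emptyset^{(\omega)}\le_T H$. -/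

import Mathlib

/-- A finite set `s` of natural numbers is exactly `ω`-large if `|s| = 1 + min s`
(in particular `s` is nonempty, so that `min s` makes sense). -/
def ExactlyOmegaLarge (s : Finset ℕ) : Prop :=
  ∃ h : s.Nonempty, s.card = 1 + s.min' h

/-- The family `[ℕ]^{!ω}` of all exactly `ω`-large sets. -/
abbrev OmegaLargeSets : Type := {s : Finset ℕ // ExactlyOmegaLarge s}

/-- A coloring of the exactly `ω`-large sets is computable if some computable function on finite
sequences of natural numbers returns the color of `s` when it is given the elements of `s` in
increasing order. (Exact `ω`-largeness is decidable, so that asking for a total function on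
sequences is no restriction.) -/
def ComputableColoring (f : OmegaLargeSets → ℕ) : Prop :=
  ∃ F : List ℕ → ℕ, Computable F ∧ ∀ s : OmegaLargeSets, F (s.1.sort (· ≤ ·)) = f s

/-- `H` is free for `f`: for every exactly `ω`-large `s ⊆ H`, `f s ∉ H \ s`. -/
def IsFreeFor (f : OmegaLargeSets → ℕ) (H : Set ℕ) : Prop :=
  ∀ s : OmegaLargeSets, (s.1 : Set ℕ) ⊆ H → f s ∉ H \ (s.1 : Set ℕ)

open Classical in
/-- The characteristic function of a set of natural numbers, as an oracle. -/
noncomputable def charFun (X : Set ℕ) : ℕ →. ℕ :=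
  fun n => Part.some (if n ∈ X then 1 else 0)

/-- `X` computes `A` (that is, `A ≤_T X`). -/
def Computes (X A : Set ℕ) : Prop :=
  TuringReducible (charFun A) (charFun X)

open Classical in
/-- The initial segment of length `k` of (the characteristic sequence of) `X`. -/
noncomputable def initSeg (X : Set ℕ) (k : ℕ) : List Bool :=
  (List.range k).map fun i => decide (i ∈ X)

/-- The `e`-th set `W_e^X` computably enumerable in `X`: a number `x` is in it iff the `e`-th
partial computable function halts on input `(σ, x)` for some finite initial segment `σ` of `X`
(an oracle computation that halts has only used a finite part of its oracle). -/
def ceSet (X : Set ℕ) (e : ℕ) : Set ℕ :=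
  {x | ∃ k : ℕ, ((Denumerable.ofNat Nat.Partrec.Code e).eval
    (Encodable.encode (initSeg X k, x))).Dom}

/-- The Turing jump `X' = {e | e ∈ W_e^X}`, the halting problem relative to `X`. -/
def turingJump (X : Set ℕ) : Set ℕ :=
  {e | e ∈ ceSet X e}

/-- The `ω`-jump `X^(ω) = ⨁ₙ X^(n) = {⟨n, x⟩ | x ∈ X^(n)}`, where `X^(n)` is the `n`-th iterate of
the Turing jump on `X`. -/
def omegaJump (X : Set ℕ) : Set ℕ :=
  {m | m.unpair.2 ∈ turingJump^[m.unpair.1] X}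

/-!
Write `A j` for the `j`-th jump of `∅`. An initial segment of `A j` of length `v` gives a guess at
`A (j + 1)` below `u`: run the programs with the segment as oracle for `v` steps. The guess only
improves with `v` and is right for all large `v`; `JumpGap n u v` says that it is right for all
`j < n`. Hence a list `z₀, …, zₘ` with good gaps computes `A m` below `z₀`
(`nestedSeg_eq_initSeg`), and it is enough that a free set bounds, for each of its elements `x`,
how far one has to go to find a `v` with `JumpGap n x v`, where `n` grows with `x`.

An exactly `ω`-large set with minimum `x` is split as `{x} ∪ P ∪ Z`, where `Z` consists of its last
`x / 2` elements. Its color is the number of `y ∈ P` for which the gap from `x` to `y` looks good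
when the jumps involved are computed from `Z`. Suppose that `H` is free, `c ∈ H`, that
`x ∈ H` is larger than `2 * c`, and that `(x, v]` contains at least `x` elements of `H`. If the gap
from `x` to `v` were bad, then so would be the gap from `x` to each element of `H` in `(x, v]`.
Take for `P` some of these elements followed by exactly `c` very large elements of `H`, and for `Z`
a list from `H`, beyond `P` and with good gaps, so that `Z` judges correctly. The color of the
resulting set is `c`, an element of `H` below the minimum of the set, which contradicts freeness
(`jumpGap_of_isFreeFor`). So every interval of `H` from `x` that contains at least `x` elements of
`H` is a good gap, and with oracle `H` one can find lists with good gaps by search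
(`computes_of_search`), uniformly in the number of jumps.
-/

open Nat.Partrec (Code)

/-! ### Finite approximations of the iterated jump -/

theorem initSeg_length (X : Set ℕ) (k : ℕ) : (initSeg X k).length = k := by
  simp [initSeg]

theorem initSeg_take (X : Set ℕ) {k n : ℕ} (h : k ≤ n) : (initSeg X n).take k = initSeg X k := by
  simp [initSeg, ← List.map_take, List.take_range, h]

theorem getD_initSeg_eq_true (X : Set ℕ) (i k : ℕ) :
    (initSeg X k).getD i false = true ↔ i < k ∧ i ∈ X := by
  by_cases h : i < k <;> simp [initSeg, List.getD_eq_getElem?_getD, h]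

/-- The guess whether `e ∈ X'` made from an initial segment `σ` of `X`: the `e`-th program is run
for `σ.length` steps on each initial segment of `σ`. -/
def jumpBit (σ : List Bool) (e : ℕ) : Bool :=
  decide (∃ k < σ.length + 1,
    ((Denumerable.ofNat Code e).evaln σ.length (Encodable.encode (σ.take k, e))).isSome = true)

/-- The guess at the initial segment of length `u` of `X'` made from an initial segment `σ` of
`X`. -/
def jumpSeg (σ : List Bool) (u : ℕ) : List Bool :=
  (List.range u).map (jumpBit σ)

/-- For `l = [z₀, …, zₘ]`, the guess at the `m`-th jump of `∅` below `z₀` that is obtained by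
passing from a guess at the `j`-th jump below `zₘ₋ⱼ` to a guess at the `(j + 1)`-st below
`zₘ₋ⱼ₋₁`. -/
def nestedSeg (l : List ℕ) : List Bool :=
  l.foldr (fun z σ => jumpSeg σ z) []

theorem jumpBit_initSeg (X : Set ℕ) (v e : ℕ) : jumpBit (initSeg X v) e = true ↔
    ∃ k ≤ v, ∃ a, a ∈ (Denumerable.ofNat Code e).evaln v (Encodable.encode (initSeg X k, e)) := by
  simp only [jumpBit, initSeg_length, decide_eq_true_eq, Option.isSome_iff_exists, Nat.lt_succ_iff]
  refine exists_congr fun k => and_congr_right fun hk => ?_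
  rw [initSeg_take X hk]; rfl

theorem jumpBit_initSeg_mono (X : Set ℕ) {v w e : ℕ} (hvw : v ≤ w)
    (h : jumpBit (initSeg X v) e = true) : jumpBit (initSeg X w) e = true := by
  rw [jumpBit_initSeg] at h ⊢
  obtain ⟨k, hk, a, ha⟩ := h
  exact ⟨k, hk.trans hvw, a, Code.evaln_mono hvw ha⟩

theorem mem_turingJump_iff (X : Set ℕ) (e : ℕ) :
    e ∈ turingJump X ↔ ∃ v, jumpBit (initSeg X v) e = true := by
  simp only [jumpBit_initSeg, turingJump, ceSet, Set.mem_ofPred_eq, Part.dom_iff_mem]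
  constructor
  · rintro ⟨k, a, ha⟩
    obtain ⟨t, ht⟩ := Code.evaln_complete.1 ha
    exact ⟨max k t, k, le_max_left _ _, a, Code.evaln_mono (le_max_right _ _) ht⟩
  · rintro ⟨v, k, -, a, ha⟩
    exact ⟨k, a, Code.evaln_sound ha⟩

open Classical in
/-- A number outside of the jump is never guessed to be in it, so only the elements of the jump
matter. -/
theorem jumpSeg_eq_initSeg_iff (X : Set ℕ) (u v : ℕ) :
    jumpSeg (initSeg X v) u = initSeg (turingJump X) u ↔
      ∀ e < u, e ∈ turingJump X → jumpBit (initSeg X v) e = true := by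
  simp only [jumpSeg, initSeg, List.map_inj_left, List.mem_range]
  refine forall₂_congr fun e _ => ?_
  rw [Bool.eq_iff_iff, decide_eq_true_eq]
  exact ⟨fun h => h.2, fun h => ⟨fun hb => (mem_turingJump_iff X e).2 ⟨v, hb⟩, h⟩⟩

theorem exists_forall_jumpSeg_eq (X : Set ℕ) (u : ℕ) :
    ∃ v₀, ∀ v ≥ v₀, jumpSeg (initSeg X v) u = initSeg (turingJump X) u := by
  have h : ∀ e, ∃ v, e ∈ turingJump X → jumpBit (initSeg X v) e = true := fun e => by
    by_cases he : e ∈ turingJump X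
    · exact ((mem_turingJump_iff X e).1 he).imp fun _ hv _ => hv
    · exact ⟨0, fun h => absurd h he⟩
  choose m hm using h
  refine ⟨(Finset.range u).sup m, fun v hv => (jumpSeg_eq_initSeg_iff X u v).2 fun e he hX => ?_⟩
  exact jumpBit_initSeg_mono X ((Finset.le_sup (Finset.mem_range.2 he)).trans hv) (hm e hX)

/-- The true initial segments of length `v` of the first `n` iterated jumps of `∅` yield the next
jumps correctly below `u`. -/
def JumpGap (n u v : ℕ) : Prop :=
  ∀ j < n, jumpSeg (initSeg (turingJump^[j] ∅) v) u = initSeg (turingJump^[j + 1] ∅) u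

theorem JumpGap.mono_right {n u v w : ℕ} (h : JumpGap n u v) (hvw : v ≤ w) : JumpGap n u w := by
  intro j hj
  have := h j hj
  rw [Function.iterate_succ_apply', jumpSeg_eq_initSeg_iff] at this ⊢
  exact fun e he hX => jumpBit_initSeg_mono _ hvw (this e he hX)

theorem JumpGap.anti_level {m n u v : ℕ} (h : JumpGap n u v) (hmn : m ≤ n) : JumpGap m u v :=
  fun j hj => h j (hj.trans_le hmn)

theorem exists_jumpGap (n u : ℕ) : ∃ v₀, ∀ v ≥ v₀, JumpGap n u v := by
  choose m hm using fun j => exists_forall_jumpSeg_eq (turingJump^[j] ∅) u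
  refine ⟨(Finset.range n).sup m, fun v hv j hj => ?_⟩
  rw [Function.iterate_succ_apply']
  exact hm j v ((Finset.le_sup (Finset.mem_range.2 hj)).trans hv)

/-- With an empty segment no computation step is allowed, so nothing is put into the jump: the guess
is an initial segment of `∅`. -/
theorem jumpSeg_nil (u : ℕ) : jumpSeg [] u = initSeg ∅ u := by
  simp only [jumpSeg, initSeg, List.map_inj_left]
  intro e _
  simp [jumpBit, Code.evaln]

theorem nestedSeg_eq_initSeg (z : ℕ) (l : List ℕ) (h : List.IsChain (JumpGap l.length) (z :: l)) :
    nestedSeg (z :: l) = initSeg (turingJump^[l.length] ∅) z := by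
  induction l generalizing z with
  | nil => exact jumpSeg_nil z
  | cons w l ih =>
    rw [List.isChain_cons_cons] at h
    have hl : nestedSeg (w :: l) = _ :=
      ih w (h.2.imp fun a b hab => hab.anti_level (Nat.le_succ _))
    change jumpSeg (nestedSeg (w :: l)) z = _
    rw [hl]
    exact h.1 l.length (Nat.lt_succ_self _)

/-- An infinite set contains increasing lists of any length, above any bound, whose consecutive
elements satisfy a relation that holds between each `u` and all sufficiently large `v`. -/
theorem exists_chain {H : Set ℕ} (hH : H.Infinite) {R : ℕ → ℕ → Prop}
    (hR : ∀ u, ∃ v₀, ∀ v ≥ v₀, R u v) (n b : ℕ) :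
    ∃ l : List ℕ, l.length = n ∧ (∀ z ∈ l, z ∈ H ∧ b < z) ∧
      List.IsChain (fun u v => u < v ∧ R u v) l := by
  induction n generalizing b with
  | zero => exact ⟨[], by simp⟩
  | succ n ih =>
    obtain ⟨u, hu, hbu⟩ := hH.exists_gt b
    obtain ⟨v₀, hv₀⟩ := hR u
    obtain ⟨l, hl, hlH, hc⟩ := ih (max u v₀)
    refine ⟨u :: l, by simp [hl], ?_, ?_⟩
    · rintro z (_ | ⟨_, hz⟩)
      · exact ⟨hu, hbu⟩
      · exact ⟨(hlH z hz).1, hbu.trans ((le_max_left _ _).trans_lt (hlH z hz).2)⟩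
    · cases l with
      | nil => simp
      | cons v l =>
        have hv := hlH v (by simp)
        have := max_lt_iff.1 hv.2
        exact List.isChain_cons_cons.2 ⟨⟨this.1, hv₀ v this.2.le⟩, hc⟩

/-! ### The coloring and its free sets -/

/-- The decidable counterpart of `JumpGap (Z.length - 1) x y` in which the iterated jumps are
replaced by the guesses obtained from the end segments of `Z`. -/
def Passes (x : ℕ) (Z : List ℕ) (y : ℕ) : Prop :=
  ∀ i < Z.length - 1,
    jumpSeg ((nestedSeg (Z.drop (i + 1))).take y) x = (nestedSeg (Z.drop i)).take x

instance (x : ℕ) (Z : List ℕ) : DecidablePred (Passes x Z) := fun _ => Nat.decidableBallLT _ _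

theorem passes_iff {x y : ℕ} {Z : List ℕ} (hx : ∀ z ∈ Z, x ≤ z) (hy : ∀ z ∈ Z, y ≤ z)
    (hZ : Z.IsChain (JumpGap Z.length)) : Passes x Z y ↔ JumpGap (Z.length - 1) x y := by
  have key (i w : ℕ) (hi : i < Z.length) (hw : ∀ z ∈ Z, w ≤ z) :
      (nestedSeg (Z.drop i)).take w = initSeg (turingJump^[Z.length - 1 - i] ∅) w := by
    have hlen : (Z.drop (i + 1)).length = Z.length - 1 - i := by simp; omega
    have hc : (Z.drop i).IsChain (JumpGap (Z.drop (i + 1)).length) :=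
      (hZ.drop i).imp fun a b hab => hab.anti_level (by simp)
    rw [List.drop_eq_getElem_cons hi] at hc ⊢
    rw [nestedSeg_eq_initSeg _ _ hc, initSeg_take _ (hw _ (List.getElem_mem hi)), hlen]
  have key' (i : ℕ) (hi : i < Z.length - 1) :
      (jumpSeg ((nestedSeg (Z.drop (i + 1))).take y) x = (nestedSeg (Z.drop i)).take x) ↔
        jumpSeg (initSeg (turingJump^[Z.length - 2 - i] ∅) y) x =
          initSeg (turingJump^[Z.length - 2 - i + 1] ∅) x := by
    rw [key (i + 1) y (by omega) hy, key i x (by omega) hx,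
      show Z.length - 1 - (i + 1) = Z.length - 2 - i by omega,
      show Z.length - 1 - i = Z.length - 2 - i + 1 by omega]
  constructor
  · intro h j hj
    have := (key' (Z.length - 2 - j) (by omega)).1 (h _ (by omega))
    rwa [show Z.length - 2 - (Z.length - 2 - j) = j by omega] at this
  · exact fun h i hi => (key' i hi).2 (h _ (by omega))

/-- The color of a set with increasing list of elements `l`. With `x = l.headI` the minimum and
`l.length = x + 1`, the last `x / 2` elements are used as the list `Z` of `Passes`, and the color is
the number of the elements strictly between `x` and `Z` that pass. -/
def jumpColor (l : List ℕ) : ℕ :=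
  ((l.tail.take (l.headI - l.headI / 2)).filter
    (Passes l.headI (l.tail.drop (l.headI - l.headI / 2)))).length

/-- In a set that is free for `jumpColor`, passing over `x` elements of the set beyond `x` reaches a
point that is far enough to compute `x / 2 - 1` jumps below `x`. -/
theorem jumpGap_of_isFreeFor {f : OmegaLargeSets → ℕ} {H : Set ℕ} {c x v : ℕ} {l : List ℕ}
    (hf : ∀ s : OmegaLargeSets, jumpColor (s.1.sort (· ≤ ·)) = f s) (hH : H.Infinite)
    (hfree : IsFreeFor f H) (hc : c ∈ H) (hx : x ∈ H) (hcx : 2 * c < x)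
    (hl : l.Pairwise (· < ·)) (hlH : ∀ y ∈ l, y ∈ H ∧ x < y ∧ y ≤ v) (hlen : x ≤ l.length) :
    JumpGap (x / 2 - 1) x v := by
  by_contra hbad
  obtain ⟨v₀, hv₀⟩ := exists_jumpGap (x / 2) x
  obtain ⟨t, ht, htH, htc⟩ := exists_chain hH (exists_jumpGap (x / 2)) (c + x / 2)
    (max (max x v) v₀)
  have htlt : t.Pairwise (· < ·) := List.isChain_iff_pairwise.1 (htc.imp fun _ _ h => h.1)
  -- `S` is the bad part of `P`; the first `c` elements of `t` are its good part, the
  -- others form `Z`.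
  set p := x - x / 2 - c with hp
  set S := l.take p with hS
  have hSl : S.length = p := by simp [hS]; omega
  have hSH : ∀ y ∈ S, y ∈ H ∧ x < y ∧ y ≤ v := fun y hy => hlH y (List.mem_of_mem_take hy)
  set Z := t.drop c with hZ
  have hZl : Z.length = x / 2 := by simp [hZ, ht]
  have htb : ∀ z ∈ t, z ∈ H ∧ x < z ∧ v < z ∧ v₀ < z := fun z hz => by
    have := htH z hz
    simp only [max_lt_iff] at this
    tauto
  have hZt : ∀ z ∈ Z, z ∈ t := fun z hz => List.mem_of_mem_drop hz
  have hZc : Z.IsChain (JumpGap Z.length) := by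
    rw [hZl]
    exact (htc.drop c).imp fun _ _ h => h.2
  set L := x :: (S ++ t) with hL
  have hLlt : L.Pairwise (· < ·) := by
    rw [hL, List.pairwise_cons, List.pairwise_append]
    refine ⟨fun y hy => ?_, hl.sublist (List.take_sublist _ _), htlt, fun a ha b hb => ?_⟩
    · rcases List.mem_append.1 hy with hy | hy
      exacts [(hSH y hy).2.1, (htb y hy).2.1]
    · exact (hSH a ha).2.2.trans_lt (htb b hb).2.2.1
  have hLH : ∀ y ∈ L, y ∈ H ∧ x ≤ y := fun y hy => by
    rcases List.mem_cons.1 hy with rfl | hy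
    · exact ⟨hx, le_rfl⟩
    rcases List.mem_append.1 hy with hy | hy
    exacts [⟨(hSH y hy).1, (hSH y hy).2.1.le⟩, ⟨(htb y hy).1, (htb y hy).2.1.le⟩]
  have hnd : L.Nodup := hLlt.imp ne_of_lt
  have hsort : L.toFinset.sort (· ≤ ·) = L :=
    (List.toFinset_sort (· ≤ ·) hnd).2 (hLlt.imp le_of_lt)
  have hlarge : ExactlyOmegaLarge L.toFinset := by
    refine ⟨⟨x, by simp [hL]⟩, ?_⟩
    have hmin : L.toFinset.min' ⟨x, by simp [hL]⟩ = x := by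
      refine le_antisymm (Finset.min'_le _ _ (by simp [hL])) (Finset.le_min' _ _ _ fun y hy => ?_)
      exact (hLH y (List.mem_toFinset.1 hy)).2
    rw [hmin, List.toFinset_card_of_nodup hnd]
    simp only [hL, List.length_cons, List.length_append, hSl, ht]
    omega
  have hcolor : jumpColor L = c := by
    -- `jumpColor` cuts `S ++ t` exactly where `Z` begins.
    have hq : x - x / 2 = S.length + c := by omega
    have h1 : (S ++ t).take (x - x / 2) = S ++ t.take c := by
      rw [hq, List.take_length_add_append]
    have h2 : (S ++ t).drop (x - x / 2) = Z := by
      rw [hq, List.drop_length_add_append]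
    have hpass : ∀ y, (∀ z ∈ Z, y ≤ z) → (Passes x Z y ↔ JumpGap (x / 2 - 1) x y) := fun y hy => by
      rw [passes_iff (fun z hz => (htb z (hZt z hz)).2.1.le) hy hZc, hZl]
    have h3 : S.filter (Passes x Z) = [] := by
      refine List.filter_eq_nil_iff.2 fun y hy => ?_
      rw [decide_eq_true_eq, hpass y fun z hz =>
        (hSH y hy).2.2.trans (htb z (hZt z hz)).2.2.1.le]
      exact fun h => hbad (h.mono_right (hSH y hy).2.2)
    have h4 : (t.take c).filter (Passes x Z) = t.take c := by
      refine List.filter_eq_self.2 fun y hy => ?_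
      have hy' := htb y (List.mem_of_mem_take hy)
      rw [decide_eq_true_eq, hpass y]
      · exact (hv₀ y hy'.2.2.2.le).anti_level (Nat.sub_le _ _)
      · have := htlt
        rw [← List.take_append_drop c t, List.pairwise_append] at this
        exact fun z hz => (this.2.2 y hy z hz).le
    simp only [jumpColor, hL, List.tail_cons, List.headI_cons, h1, h2, List.filter_append, h3, h4]
    simp [ht]
  have hfs : f ⟨L.toFinset, hlarge⟩ = c := by rw [← hf, hsort, hcolor]
  refine hfree ⟨L.toFinset, hlarge⟩ (fun y hy => (hLH y (by simpa using hy)).1) ?_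
  rw [hfs]
  refine ⟨hc, fun hcL => ?_⟩
  have := (hLH c (by simpa using hcL)).2
  omega

/-! ### Searching with an oracle -/

/-- The list of Booleans with code `n`, or `[]` if there is none. -/
def decodeBools (n : ℕ) : List Bool :=
  (Encodable.decode (α := List Bool) n).getD []

theorem primrec_decodeBools : Primrec decodeBools :=
  Primrec.option_getD.comp Primrec.decode (Primrec.const [])

theorem decodeBools_encode (σ : List Bool) : decodeBools (Encodable.encode σ) = σ := by
  simp [decodeBools]

/-- The total function `F` is recursive in the oracles `O`. -/
def TotalIn (O : Set (ℕ →. ℕ)) (F : ℕ → ℕ) : Prop :=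
  Nat.RecursiveIn O fun n => Part.some (F n)

section

variable {O : Set (ℕ →. ℕ)} {F G : ℕ → ℕ}

theorem TotalIn.of_primrec (hF : Primrec F) : TotalIn O F :=
  (Primrec.nat_iff.1 hF).recursiveIn

theorem TotalIn.comp (hF : TotalIn O F) (hG : TotalIn O G) : TotalIn O fun n => F (G n) :=
  (Nat.RecursiveIn.comp hF hG).of_eq fun n => by simp

theorem TotalIn.pair (hF : TotalIn O F) (hG : TotalIn O G) :
    TotalIn O fun n => Nat.pair (F n) (G n) :=
  (Nat.RecursiveIn.pair hF hG).of_eq fun n => by simp [Seq.seq]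

/-- Recursion without parameters. -/
theorem TotalIn.of_step {h s : ℕ → ℕ} (hh : TotalIn O h)
    (hs : ∀ n, s (n + 1) = h (Nat.pair n (s n))) : TotalIn O s := by
  have hp := Nat.RecursiveIn.prec (TotalIn.of_primrec (O := O) (Primrec.const (s 0)))
    (hh.comp (TotalIn.of_primrec (Primrec.snd.comp Primrec.unpair)))
  refine (Nat.RecursiveIn.comp hp
    ((TotalIn.of_primrec (Primrec.const 0)).pair (TotalIn.of_primrec Primrec.id))).of_eq fun n => ?_
  simp only [Part.bind_eq_bind, Part.bind_some, Nat.unpair_pair, id]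
  induction n with
  | zero => rfl
  | succ n ih => simp only [ih, Part.bind_some, hs]

open Classical in
theorem TotalIn.encode_initSeg (H : Set ℕ) :
    TotalIn {charFun H} fun n => Encodable.encode (initSeg H n) := by
  have hχ : TotalIn {charFun H} fun n => if n ∈ H then 1 else 0 := .oracle _ rfl
  -- On `⟨b, code of σ⟩`, append the bit `b` to `σ`; iterated along the oracle this lists its bits.
  let snoc : ℕ → ℕ := fun q =>
    Encodable.encode (decodeBools q.unpair.2 ++ [decide (q.unpair.1 = 1)])
  have hsnoc : Primrec snoc := by
    refine Primrec.encode.comp (Primrec.list_concat.comp ?_ ?_)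
    · exact primrec_decodeBools.comp (Primrec.snd.comp Primrec.unpair)
    · exact (Primrec.eq.comp (Primrec.fst.comp Primrec.unpair) (Primrec.const 1)).decide
  have hstep := (TotalIn.of_primrec hsnoc).comp
    ((hχ.comp (TotalIn.of_primrec (Primrec.fst.comp Primrec.unpair))).pair
      (TotalIn.of_primrec (Primrec.snd.comp Primrec.unpair)))
  refine hstep.of_step fun n => ?_
  by_cases hn : n ∈ H <;>
    simp [snoc, decodeBools_encode, initSeg, List.range_succ, hn]

end

/-- `H` computes `A` if membership of `n` in `A` can be read off from any witness `t` that passes a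
primitive recursive test `Q`, where the test may use the initial segment of `H` whose length is the
first component of `t`. -/
theorem computes_of_search {A H : Set ℕ} {Q : List Bool × ℕ × ℕ → Prop} {out : ℕ × ℕ → Bool}
    (hQ : PrimrecPred Q) (hout : Primrec out)
    (hex : ∀ n, ∃ t, Q (initSeg H t.unpair.1, t, n))
    (hcorrect : ∀ n t, Q (initSeg H t.unpair.1, t, n) → (out (t, n) = true ↔ n ∈ A)) :
    Computes H A := by
  classical
  have hl : Primrec fun p : ℕ => p.unpair.1 := Primrec.fst.comp Primrec.unpair
  have hr : Primrec fun p : ℕ => p.unpair.2 := Primrec.snd.comp Primrec.unpair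
  have htest : TotalIn {charFun H} fun p =>
      if Q (initSeg H p.unpair.2.unpair.1, p.unpair.2, p.unpair.1) then 0 else 1 := by
    have hF : Primrec fun q : ℕ =>
        if Q (decodeBools q.unpair.2, q.unpair.1.unpair.2, q.unpair.1.unpair.1)
          then 0 else 1 :=
      Primrec.ite (hQ.comp ((primrec_decodeBools.comp hr).pair
        ((hr.comp hl).pair (hl.comp hl)))) (Primrec.const 0) (Primrec.const 1)
    refine Nat.RecursiveIn.of_eq ((TotalIn.of_primrec hF).comp
      ((TotalIn.of_primrec Primrec.id).pair
        ((TotalIn.encode_initSeg H).comp (TotalIn.of_primrec (hl.comp hr))))) fun p => ?_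
    simp [decodeBools_encode]
  have hout' : TotalIn {charFun H} fun p => (out (p.unpair.2, p.unpair.1)).toNat :=
    TotalIn.of_primrec ((Primrec.dom_bool Bool.toNat).comp (hout.comp (hr.pair hl)))
  have hfind := Nat.RecursiveIn.comp hout' (Nat.RecursiveIn.pair
    (TotalIn.of_primrec Primrec.id) (Nat.RecursiveIn.rfind htest))
  rw [Computes, TuringReducible, RecursiveIn.iff_nat]
  refine hfind.of_eq_tot fun n => ?_
  obtain ⟨t, ht⟩ : ∃ t, t ∈ Nat.rfind fun t => (fun m => decide (m = 0)) <$> (Part.some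
      (if Q (initSeg H (Nat.pair n t).unpair.2.unpair.1, (Nat.pair n t).unpair.2,
        (Nat.pair n t).unpair.1) then 0 else 1 : ℕ)) := by
    obtain ⟨t, ht⟩ := hex n
    exact Part.dom_iff_mem.1 (Nat.rfind_dom.2 ⟨t, by simp [ht], fun _ => trivial⟩)
  have hQt : Q (initSeg H t.unpair.1, t, n) := by
    have := Nat.rfind_spec ht
    simpa using this
  rw [Part.eq_some_iff.2 ht]
  have := hcorrect n t hQt
  by_cases hn : n ∈ A
  · simp [Seq.seq, hn, this.2 hn]
  · have hf : out (t, n) = false := by simpa [hn] using this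
    simp [Seq.seq, hn, hf]

/-! ### The coloring is primitive recursive -/

theorem PrimrecRel.forall_lt_nat {α : Type*} [Primcodable α] {R : ℕ → α → Prop}
    (hR : PrimrecRel R) : PrimrecRel fun (n : ℕ) a => ∀ i < n, R i a :=
  (hR.forall_mem_list.comp (Primrec.list_range.comp Primrec.fst) Primrec.snd).of_eq (by simp)

theorem primrec_jumpBit : Primrec₂ jumpBit := by
  have hR : PrimrecRel fun (k : ℕ) (p : List Bool × ℕ) =>
      ((Denumerable.ofNat Code p.2).evaln p.1.length
        (Encodable.encode (p.1.take k, p.2))).isSome = true := by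
    have he : Primrec fun q : ℕ × List Bool × ℕ => q.2.2 := Primrec.snd.comp Primrec.snd
    have hσ : Primrec fun q : ℕ × List Bool × ℕ => q.2.1 := Primrec.fst.comp Primrec.snd
    refine Primrec.eq.comp (Primrec.option_isSome.comp (Code.primrec_evaln.comp
      (((Primrec.list_length.comp hσ).pair ((Primrec.ofNat Code).comp he)).pair
        (Primrec.encode.comp ((Primrec.list_take.comp Primrec.fst hσ).pair he)))))
      (Primrec.const true)
  exact (hR.exists_mem_list.comp (Primrec.list_range.comp (Primrec.succ.comp
    (Primrec.list_length.comp Primrec.fst))) Primrec.id).decide.of_eq fun p => by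
      simp [jumpBit]

theorem primrec_jumpSeg : Primrec₂ jumpSeg :=
  Primrec.list_map (Primrec.list_range.comp Primrec.snd)
    (primrec_jumpBit.comp (Primrec.fst.comp Primrec.fst) Primrec.snd)

theorem primrec_nestedSeg : Primrec nestedSeg :=
  Primrec.list_foldr Primrec.id (Primrec.const [])
    (primrec_jumpSeg.comp (Primrec.snd.comp Primrec.snd) (Primrec.fst.comp Primrec.snd)).to₂

theorem primrecRel_passes : PrimrecRel fun (y : ℕ) (q : ℕ × List ℕ) => Passes q.1 q.2 y := by
  have hR : PrimrecRel fun (i : ℕ) (r : ℕ × ℕ × List ℕ) =>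
      jumpSeg ((nestedSeg (r.2.2.drop (i + 1))).take r.1) r.2.1 =
        (nestedSeg (r.2.2.drop i)).take r.2.1 := by
    have hy : Primrec fun p : ℕ × ℕ × ℕ × List ℕ => p.2.1 := Primrec.fst.comp Primrec.snd
    have hx : Primrec fun p : ℕ × ℕ × ℕ × List ℕ => p.2.2.1 :=
      Primrec.fst.comp (Primrec.snd.comp Primrec.snd)
    have hZ : Primrec fun p : ℕ × ℕ × ℕ × List ℕ => p.2.2.2 :=
      Primrec.snd.comp (Primrec.snd.comp Primrec.snd)
    refine Primrec.eq.comp (primrec_jumpSeg.comp (Primrec.list_take.comp hy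
      (primrec_nestedSeg.comp (Primrec.list_drop.comp (Primrec.succ.comp Primrec.fst) hZ))) hx)
      (Primrec.list_take.comp hx (primrec_nestedSeg.comp (Primrec.list_drop.comp Primrec.fst hZ)))
  exact hR.forall_lt_nat.comp (Primrec.nat_sub.comp
    (Primrec.list_length.comp (Primrec.snd.comp Primrec.snd)) (Primrec.const 1)) Primrec.id

theorem primrec_jumpColor : Primrec jumpColor := by
  have hhead : Primrec (List.headI : List ℕ → ℕ) := Primrec.list_headI
  have hk : Primrec fun l : List ℕ => l.headI - l.headI / 2 :=
    Primrec.nat_sub.comp hhead (Primrec.nat_div.comp hhead (Primrec.const 2))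
  exact Primrec.list_length.comp (primrecRel_passes.listFilter.comp
    (Primrec.list_take.comp hk Primrec.list_tail)
    (hhead.pair (Primrec.list_drop.comp hk Primrec.list_tail)))

/-! ### Chains recognized from an initial segment of a free set -/

/-- The increasing list of the elements in `(u, v]` of the finite set with characteristic sequence
`σ`. -/
def segBetween (σ : List Bool) (u v : ℕ) : List ℕ :=
  (List.range (v + 1)).filter fun i => u < i ∧ σ.getD i false = true

theorem mem_segBetween {H : Set ℕ} {k u v i : ℕ} :
    i ∈ segBetween (initSeg H k) u v ↔ u < i ∧ i ≤ v ∧ i < k ∧ i ∈ H := by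
  simp only [segBetween, List.mem_filter, List.mem_range, decide_eq_true_eq, getD_initSeg_eq_true]
  grind

theorem exists_le_length_segBetween {H : Set ℕ} (hH : H.Infinite) (u : ℕ) :
    ∃ v₀, ∀ v ≥ v₀, ∀ k > v, u ≤ (segBetween (initSeg H k) u v).length := by
  obtain ⟨l, hl, hlH, hc⟩ := exists_chain hH (R := fun _ _ => True) (fun _ => ⟨0, by simp⟩) u u
  have hnd : l.Nodup :=
    (List.isChain_iff_pairwise.1 (hc.imp fun _ _ h => h.1)).imp (fun h => ne_of_lt h)
  refine ⟨l.sum, fun v hv k hk => ?_⟩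
  refine hl.symm.le.trans (hnd.subperm fun z hz => ?_).length_le
  have := List.le_sum_of_mem hz
  exact mem_segBetween.2 ⟨(hlH z hz).2, by omega, by omega, (hlH z hz).1⟩

/-- `l` is a list of `m + 1` numbers above `b` that belong to the finite set with characteristic
sequence `σ`, and between each of them, `u`, and the next one there are at least `u` elements of
that set (the next one included). -/
def ValidChain (b m : ℕ) (σ : List Bool) (l : List ℕ) : Prop :=
  l.length = m + 1 ∧ (∀ z ∈ l, b < z ∧ σ.getD z false = true) ∧
    ∀ i < m, l.getD i 0 ≤ (segBetween σ (l.getD i 0) (l.getD (i + 1) 0)).length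

theorem exists_validChain {H : Set ℕ} (hH : H.Infinite) (b m : ℕ) :
    ∃ k l, ValidChain b m (initSeg H k) l := by
  obtain ⟨l, hl, hlH, hc⟩ := exists_chain hH (exists_le_length_segBetween hH) (m + 1) b
  refine ⟨l.sum + 1, l, hl, fun z hz => ⟨(hlH z hz).2, ?_⟩, fun i hi => ?_⟩
  · exact (getD_initSeg_eq_true H z _).2 ⟨Nat.lt_succ_of_le (List.le_sum_of_mem hz), (hlH z hz).1⟩
  · have h1 : i < l.length := by omega
    have h2 : i + 1 < l.length := by omega
    rw [List.getD_eq_getElem _ _ h1, List.getD_eq_getElem _ _ h2]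
    exact (List.isChain_iff_getElem.1 hc i h2).2 _
      (Nat.lt_succ_of_le (List.le_sum_of_mem (List.getElem_mem h2)))

/-- Valid chains in a free set have good gaps, so that they compute the iterated jumps correctly. -/
theorem ValidChain.nestedSeg_eq_initSeg {f : OmegaLargeSets → ℕ} {H : Set ℕ} {b c m k : ℕ}
    {l : List ℕ} (hf : ∀ s : OmegaLargeSets, jumpColor (s.1.sort (· ≤ ·)) = f s) (hH : H.Infinite)
    (hfree : IsFreeFor f H) (hc : c ∈ H) (hb : 2 * c + 2 * m + 2 ≤ b)
    (hl : ValidChain b m (initSeg H k) l) :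
    nestedSeg l = initSeg (turingJump^[m] ∅) l.headI := by
  obtain ⟨hlen, hmem, hgap⟩ := hl
  have hchain : l.IsChain (JumpGap m) := by
    refine List.isChain_iff_getElem.2 fun i hi => ?_
    have hgi := hgap i (by omega)
    rw [List.getD_eq_getElem _ _ hi, List.getD_eq_getElem l 0 (by omega : i < l.length)] at hgi
    have hx := hmem l[i] (List.getElem_mem _)
    have hJ := jumpGap_of_isFreeFor (l := segBetween (initSeg H k) l[i] l[i + 1]) (v := l[i + 1])
      hf hH hfree hc ((getD_initSeg_eq_true H _ _).1 hx.2).2 (by omega)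
      (List.pairwise_lt_range.filter _)
      (fun y hy => by
        have := mem_segBetween.1 hy
        exact ⟨this.2.2.2, this.1, this.2.1⟩) hgi
    exact hJ.anti_level (by omega)
  obtain ⟨z, l, rfl⟩ := List.exists_cons_of_length_eq_add_one hlen
  obtain rfl : l.length = m := by simpa using hlen
  exact _root_.nestedSeg_eq_initSeg z l hchain

theorem primrec_segBetween : Primrec fun p : List Bool × ℕ × ℕ => segBetween p.1 p.2.1 p.2.2 := by
  have hR : PrimrecRel fun (i : ℕ) (p : List Bool × ℕ × ℕ) =>
      p.2.1 < i ∧ p.1.getD i false = true :=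
    (Primrec.nat_lt.comp (Primrec.fst.comp (Primrec.snd.comp Primrec.snd)) Primrec.fst).and
      (Primrec.eq.comp ((Primrec.list_getD false).comp (Primrec.fst.comp Primrec.snd) Primrec.fst)
        (Primrec.const true))
  exact hR.listFilter.comp (Primrec.list_range.comp (Primrec.succ.comp
    (Primrec.snd.comp Primrec.snd))) Primrec.id

theorem primrecPred_validChain :
    PrimrecPred fun p : (ℕ × ℕ) × List Bool × List ℕ => ValidChain p.1.1 p.1.2 p.2.1 p.2.2 := by
  have hm : Primrec fun p : (ℕ × ℕ) × List Bool × List ℕ => p.1.2 := Primrec.snd.comp Primrec.fst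
  have hl : Primrec fun p : (ℕ × ℕ) × List Bool × List ℕ => p.2.2 := Primrec.snd.comp Primrec.snd
  have hmem : PrimrecRel fun (z : ℕ) (p : (ℕ × ℕ) × List Bool × List ℕ) =>
      p.1.1 < z ∧ p.2.1.getD z false = true :=
    (Primrec.nat_lt.comp (Primrec.fst.comp (Primrec.fst.comp Primrec.snd)) Primrec.fst).and
      (Primrec.eq.comp ((Primrec.list_getD false).comp
        (Primrec.fst.comp (Primrec.snd.comp Primrec.snd)) Primrec.fst) (Primrec.const true))
  have hgap : PrimrecRel fun (i : ℕ) (p : (ℕ × ℕ) × List Bool × List ℕ) =>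
      p.2.2.getD i 0 ≤ (segBetween p.2.1 (p.2.2.getD i 0) (p.2.2.getD (i + 1) 0)).length := by
    have hl' : Primrec fun q : ℕ × (ℕ × ℕ) × List Bool × List ℕ => q.2.2.2 :=
      hl.comp Primrec.snd
    have hu := (Primrec.list_getD 0).comp hl' Primrec.fst
    have hv := (Primrec.list_getD 0).comp hl' (Primrec.succ.comp Primrec.fst)
    exact Primrec.nat_le.comp hu (Primrec.list_length.comp (primrec_segBetween.comp
      ((Primrec.fst.comp (Primrec.snd.comp Primrec.snd)).pair (hu.pair hv))))
  exact (Primrec.eq.comp (Primrec.list_length.comp hl) (Primrec.succ.comp hm)).and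
    ((hmem.forall_mem_list.comp hl Primrec.id).and (hgap.forall_lt_nat.comp hm Primrec.id))

/-! ### Computing the `ω`-jump from a free set -/

theorem mainTheorem6 :
    ∃ f : OmegaLargeSets → ℕ, ComputableColoring f ∧
      ∀ H : Set ℕ, H.Infinite → IsFreeFor f H → Computes H (omegaJump ∅) := by
  refine ⟨fun s => jumpColor (s.1.sort (· ≤ ·)),
    ⟨jumpColor, primrec_jumpColor.to_comp, fun _ => rfl⟩, fun H hH hfree => ?_⟩
  -- Any fixed element `c` of `H` will do as the color to be avoided.
  obtain ⟨c, hc⟩ := hH.nonempty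
  have hl : Primrec fun n : ℕ => n.unpair.1 := Primrec.fst.comp Primrec.unpair
  have hr : Primrec fun n : ℕ => n.unpair.2 := Primrec.snd.comp Primrec.unpair
  -- The summand `n.unpair.2` makes the initial segment that is computed long enough to contain the
  -- number `n.unpair.2`; the others are those required for `n.unpair.1` jumps.
  let bound : ℕ → ℕ := fun n => 2 * c + 2 * n.unpair.1 + 2 + n.unpair.2
  have hbound : Primrec bound :=
    Primrec.nat_add.comp (Primrec.nat_add.comp (Primrec.nat_add.comp (Primrec.const (2 * c))
      (Primrec.nat_mul.comp (Primrec.const 2) hl)) (Primrec.const 2)) hr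
  let chain : ℕ → List ℕ := fun t => Denumerable.ofNat (List ℕ) t.unpair.2
  have hchain : Primrec chain := (Primrec.ofNat (List ℕ)).comp hr
  refine computes_of_search
    (Q := fun p => ValidChain (bound p.2.2) p.2.2.unpair.1 p.1 (chain p.2.1))
    (out := fun p => (nestedSeg (chain p.1)).getD p.2.unpair.2 false) ?_ ?_ ?_ ?_
  · have hn : Primrec fun p : List Bool × ℕ × ℕ => p.2.2 := Primrec.snd.comp Primrec.snd
    exact primrecPred_validChain.comp (((hbound.comp hn).pair (hl.comp hn)).pair
      (Primrec.fst.pair (hchain.comp (Primrec.fst.comp Primrec.snd))))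
  · exact (Primrec.list_getD false).comp (primrec_nestedSeg.comp (hchain.comp Primrec.fst))
      (hr.comp Primrec.snd)
  · intro n
    obtain ⟨k, l, hkl⟩ := exists_validChain hH (bound n) n.unpair.1
    exact ⟨Nat.pair k (Encodable.encode l), by simpa [chain] using hkl⟩
  · intro n t hQ
    have hz : n.unpair.2 < (chain t).headI := by
      obtain ⟨z, l, hzl⟩ := List.exists_cons_of_length_eq_add_one hQ.1
      have := (hQ.2.1 z (by simp [hzl])).1
      simp only [hzl, List.headI_cons]
      exact (Nat.le_add_left _ _ : n.unpair.2 ≤ bound n).trans_lt this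
    simp only [hQ.nestedSeg_eq_initSeg (fun _ => rfl) hH hfree hc (Nat.le_add_right _ _),
      getD_initSeg_eq_true, hz, true_and]
    rfl
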